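/- \textbf{Theorem.} Let $\mathcal S_0$ be a compact smooth $n$-dimensional manifold without boundary, $I\subset\mathbb R$ an open interval, and let $N=I\times\mathcal S_0$ be equipped with a smooth Lorentzian metric which in the Gaussian coordinates $(x^0,x^i)$, where $x^0\in I$ is future directed and $(x^i)$ are local coordinates of $\mathcal S_0$, has the form $$d\bar s^2=e^{2\psi}\{-(dx^0)^2+\sigma_{ij}(x^0,x)\,dx^i\,dx^j\},$$ with $\psi\in C^\infty(I\times\mathcal S_0)$ and $\sigma_{ij}(x^0,\cdot)$ a family of Riemannian metrics on $\mathcal S_0$ depending smoothly on $(x^0,x)$. Let $\kappa_0\in\mathbb R$ and let $[a,b]\subset I$ be a compact interval. Then there exists a constant $c=c(a,b,\mathcal S_0,\sigma_{ij},\psi,\kappa_0)$ with the following property. Let $u\in C^2(\mathcal S_0)$ with $a\le u\le b$ be such that $M=\operatorname{graph}u=\{(u(x),x):x\in\mathcal S_0\}$ is spacelike, i.e. its induced metric is Riemannian, and let $\kappa_i$ be the principal curvatures of $M$, i.e. the eigenvalues, with respect to the induced metric, of the second fundamental form $(h_{ij})$ defined by the Gauss formula $x^\alpha_{ij}=h_{ij}\nu^\alpha$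 with the past directed unit normal $\nu$. Assume that the principal curvatures are bounded from one side by $\kappa_0$, i.e. either $$\kappa_i\ge\kappa_0\ \text{ for all } i \text{ everywhere on } M,\qquad\text{or}\qquad \kappa_i\le\kappa_0\ \text{ for all } i \text{ everywhere on } M.$$ Then $$\tilde v=\frac1{\sqrt{1-|Du|^2}}\le c\quad\text{on }\mathcal S_0,\qquad\text{where } |Du|^2=\sigma^{ij}(u,x)\,u_iu_j .$$ -/

import Mathlib

open Set
open scoped Manifold ContDiff

noncomputable section

/-- A spacetime `I × S` in Gaussian coordinates, with the Lorentzian metric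
`ḡ = e^{2ψ} (-(dx⁰)² + σ_{ij}(x⁰, x) dxⁱ dxʲ)`: `ψ` is a smooth function on `I × S` and
`σ` is a family of Riemannian metrics on `S`, smooth in `(x⁰, x) ∈ I × S`.
The coordinate `x⁰ ∈ I` is future directed. Values outside of `I` carry no meaning. -/
structure GaussianSpacetime (n : ℕ) (S : Type*) [TopologicalSpace S]
    [ChartedSpace (EuclideanSpace ℝ (Fin n)) S] [IsManifold (𝓡 n) ∞ S] (I : Set ℝ) where
  ψ : ℝ → S → ℝ
  σ : ℝ → (x : S) → TangentSpace (𝓡 n) x →L[ℝ] TangentSpace (𝓡 n) x →L[ℝ] ℝ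
  symm : ∀ t ∈ I, ∀ (x : S) (X Y : TangentSpace (𝓡 n) x), σ t x X Y = σ t x Y X
  pos : ∀ t ∈ I, ∀ (x : S) (X : TangentSpace (𝓡 n) x), X ≠ 0 → 0 < σ t x X X
  smooth_ψ : ContMDiffOn (𝓘(ℝ, ℝ).prod (𝓡 n)) 𝓘(ℝ, ℝ) ∞
    (fun q : ℝ × S => ψ q.1 q.2) (I ×ˢ univ)
  smooth_σ : ContMDiffOn (𝓘(ℝ, ℝ).prod (𝓡 n))
    ((𝓡 n).prod 𝓘(ℝ, EuclideanSpace ℝ (Fin n) →L[ℝ] EuclideanSpace ℝ (Fin n) →L[ℝ] ℝ)) ∞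
    (fun q : ℝ × S => Bundle.TotalSpace.mk'
      (EuclideanSpace ℝ (Fin n) →L[ℝ] EuclideanSpace ℝ (Fin n) →L[ℝ] ℝ)
      (E := fun x : S => TangentSpace (𝓡 n) x →L[ℝ] TangentSpace (𝓡 n) x →L[ℝ] ℝ)
      q.2 (σ q.1 q.2)) (I ×ˢ univ)

namespace GaussianSpacetime

variable {n : ℕ} {S : Type*} [TopologicalSpace S]
  [ChartedSpace (EuclideanSpace ℝ (Fin n)) S] [IsManifold (𝓡 n) ∞ S] {I : Set ℝ}

/-- The ambient metric `ḡ` at `(t, x)`; a tangent vector of `I × S` at `(t, x)` is a pair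
`V = (V⁰, V')` with `V⁰ ∈ ℝ` and `V' ∈ T_x S`. -/
def metric (N : GaussianSpacetime n S I) (t : ℝ) (x : S)
    (V W : ℝ × TangentSpace (𝓡 n) x) : ℝ :=
  Real.exp (2 * N.ψ t x) * (-(V.1 * W.1) + N.σ t x V.2 W.2)

/-- The differential of `u` at `x`. -/
def du (u : S → ℝ) (x : S) : TangentSpace (𝓡 n) x →L[ℝ] ℝ :=
  mfderiv (𝓡 n) 𝓘(ℝ, ℝ) u x

/-- The push-forward of `X ∈ T_x S` under the graph embedding `x ↦ (u x, x)`. -/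
def graphPush (u : S → ℝ) (x : S) (X : TangentSpace (𝓡 n) x) :
    ℝ × TangentSpace (𝓡 n) x :=
  (du u x X, X)

/-- The induced metric `g` of `graph u` (pulled back to `S`). -/
def inducedMetric (N : GaussianSpacetime n S I) (u : S → ℝ) (x : S)
    (X Y : TangentSpace (𝓡 n) x) : ℝ :=
  N.metric (u x) x (graphPush u x X) (graphPush u x Y)

/-- `graph u` is spacelike: its induced metric is Riemannian. -/
def IsSpacelikeGraph (N : GaussianSpacetime n S I) (u : S → ℝ) : Prop :=
  ∀ (x : S) (X : TangentSpace (𝓡 n) x), X ≠ 0 → 0 < N.inducedMetric u x X X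

/-- `|Du|² = σ^{ij}(u, x) u_i u_j`; the inverse of `σ : T_x S → T_x^* S` raises the index. -/
def gradSq (N : GaussianSpacetime n S I) (u : S → ℝ) (x : S) : ℝ :=
  du u x ((N.σ (u x) x).inverse (du u x))

/-- `ṽ = 1 / √(1 - |Du|²)`. -/
def vTilde (N : GaussianSpacetime n S I) (u : S → ℝ) (x : S) : ℝ :=
  1 / √(1 - N.gradSq u x)

/-- `ν` is the past directed unit normal of `graph u` at `(u x, x)`. -/
structure IsPastNormal (N : GaussianSpacetime n S I) (u : S → ℝ) (x : S)
    (ν : ℝ × TangentSpace (𝓡 n) x) : Prop where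
  orthogonal : ∀ X : TangentSpace (𝓡 n) x, N.metric (u x) x ν (graphPush u x X) = 0
  unit : N.metric (u x) x ν ν = -1
  past : ν.1 < 0

/-- The components of the ambient metric in the Gaussian coordinates `(x⁰, y)`, where `y` are
the local coordinates of `S` given by the preferred chart at `x₀`. -/
def coordMetric (N : GaussianSpacetime n S I) (x₀ : S)
    (q V W : ℝ × EuclideanSpace ℝ (Fin n)) : ℝ :=
  N.metric q.1 ((extChartAt (𝓡 n) x₀).symm q.2)
    (V.1, mfderiv 𝓘(ℝ, EuclideanSpace ℝ (Fin n)) (𝓡 n) (extChartAt (𝓡 n) x₀).symm q.2 V.2)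
    (W.1, mfderiv 𝓘(ℝ, EuclideanSpace ℝ (Fin n)) (𝓡 n) (extChartAt (𝓡 n) x₀).symm q.2 W.2)

/-- The Christoffel symbols of the first kind of `ḡ` in these coordinates,
`½ (∂_V ḡ(W, Z) + ∂_W ḡ(V, Z) - ∂_Z ḡ(V, W))`, that is `ḡ_{αδ} Γ^δ_{βγ} Z^α V^β W^γ`. -/
def christoffel (N : GaussianSpacetime n S I) (x₀ : S)
    (q V W Z : ℝ × EuclideanSpace ℝ (Fin n)) : ℝ :=
  1 / 2 * (fderiv ℝ (fun p => N.coordMetric x₀ p W Z) q V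
    + fderiv ℝ (fun p => N.coordMetric x₀ p V Z) q W
    - fderiv ℝ (fun p => N.coordMetric x₀ p V W) q Z)

/-- The graph embedding `y ↦ (u, y)` in the coordinates given by the preferred chart at `x₀`. -/
def coordGraph (u : S → ℝ) (x₀ : S) (y : EuclideanSpace ℝ (Fin n)) :
    ℝ × EuclideanSpace ℝ (Fin n) :=
  (u ((extChartAt (𝓡 n) x₀).symm y), y)

/-- The second fundamental form `h` of `graph u` at `x` with respect to the normal `ν`, given by
the Gauss formula `x^α_{ij} = h_{ij} ν^α` with `ḡ(ν, ν) = -1`, i.e.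
`h_{ij} = -ḡ_{αδ} (x^α_{,ij} + Γ^α_{βγ} x^β_i x^γ_j) ν^δ`
(the term of `x^α_{ij}` that is tangent to the graph does not contribute).
It is computed in the preferred chart at `x`, in which Mathlib identifies `T_x S` with `ℝⁿ`. -/
def secondFundamentalForm (N : GaussianSpacetime n S I) (u : S → ℝ) (x : S)
    (ν : ℝ × TangentSpace (𝓡 n) x) (X Y : TangentSpace (𝓡 n) x) : ℝ :=
  let y₀ : EuclideanSpace ℝ (Fin n) := extChartAt (𝓡 n) x x
  let q : ℝ × EuclideanSpace ℝ (Fin n) := coordGraph u x y₀;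
  -(N.coordMetric x q (fderiv ℝ (fun y => fderiv ℝ (coordGraph u x) y Y) y₀ X) ν
    + N.christoffel x q (fderiv ℝ (coordGraph u x) y₀ X) (fderiv ℝ (coordGraph u x) y₀ Y) ν)

/-- `κ` is a principal curvature of `graph u` at `(u x, x)`: an eigenvalue of the second
fundamental form, taken with respect to the past directed normal, relative to the induced
metric. -/
def IsPrincipalCurvature (N : GaussianSpacetime n S I) (u : S → ℝ) (x : S) (κ : ℝ) : Prop :=
  ∃ ν, N.IsPastNormal u x ν ∧ ∃ X : TangentSpace (𝓡 n) x, X ≠ 0 ∧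
    ∀ Y : TangentSpace (𝓡 n) x,
      N.secondFundamentalForm u x ν X Y = κ * N.inducedMetric u x X Y

end GaussianSpacetime

end

section

open scoped Topology
set_option linter.unusedSectionVars false
set_option maxSynthPendingDepth 3
noncomputable section

/-! ### Relative eigenvalues of a pair of symmetric bilinear forms. -/

namespace LinearMap.BilinForm

variable {V : Type*} [NormedAddCommGroup V] [NormedSpace ℝ V] [FiniteDimensional ℝ V]

/-! A one-sided curvature bound controls `ṽ` through a first derivative test; no second derivative
of `|Du|²` is needed. Put `G = |Du|²` and consider `(1 - G) e^{-μu}`, which attains its minimum by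
compactness (`continuous_gradSq`). Let `ξ` be the gradient of `u` at the minimum. If `ξ = 0` then `ṽ
= 1`. Otherwise the vanishing derivative in the direction `ξ` determines `D²u(ξ, ξ)`
(`hessian_grad_of_isMin`). Inserted in the Gauss formula, this gives `h(ξ, ξ) = e^{2ψ} s (1 - G) (G
(μ/2 - ∂₀ψ - dψ(ξ)) - ½ ∂₀σ(ξ, ξ))`, with `s = ṽ e^{-ψ}` (`secondFundamentalForm_grad_of_isMin`),
whereas `g(ξ, ξ) = e^{2ψ} G (1 - G)`.

The terms other than `μ/2` are bounded by multiples of `G`, with a constant `C` that depends only on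
the geometry over `[a, b]` (`exists_isGeometryBound`). Hence a large `|μ|` fixes the sign: `h(ξ, ξ)
≤ -s g(ξ, ξ)` for very negative `μ`, and `h(ξ, ξ) ≥ s g(ξ, ξ)` for very positive `μ`. The first
contradicts `κ ≥ κ₀`, the second `κ ≤ κ₀`, unless `s ≤ |κ₀|`. So `ṽ` is bounded at the minimum, and
since `u` oscillates by at most `b - a`, it is bounded everywhere. -/

lemma continuous_apply_self (h : LinearMap.BilinForm ℝ V) : Continuous fun X => h X X := by
  let h' : V →L[ℝ] V →L[ℝ] ℝ :=
    LinearMap.toContinuousLinearMap ((LinearMap.toContinuousLinearMap :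
      (V →ₗ[ℝ] ℝ) ≃ₗ[ℝ] (V →L[ℝ] ℝ)).toLinearMap ∘ₗ h)
  have : (fun X => h X X) = fun X => h' X X := rfl
  rw [this]
  fun_prop

/-- The smallest value of `h X X / g X X` is an eigenvalue of `h` relative to `g`. -/
lemma exists_min_relative_eigenvalue [Nontrivial V] (h g : LinearMap.BilinForm ℝ V)
    (h_symm : ∀ X Y, h X Y = h Y X) (g_symm : ∀ X Y, g X Y = g Y X)
    (g_pos : ∀ X, X ≠ 0 → 0 < g X X) :
    ∃ m : ℝ, ∃ X : V, X ≠ 0 ∧ (∀ Y, h X Y = m * g X Y) ∧ ∀ Y, m * g Y Y ≤ h Y Y := by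
  have hne : ∀ X ∈ Metric.sphere (0 : V) 1, X ≠ 0 := by
    intro X hX h0
    simp [h0] at hX
  obtain ⟨X, hX, hmin⟩ := (isCompact_sphere (0 : V) 1).exists_isMinOn
    (NormedSpace.sphere_nonempty.2 zero_le_one)
    (f := fun X => h X X / g X X)
    (h.continuous_apply_self.continuousOn.div g.continuous_apply_self.continuousOn
      fun X hX => (g_pos X (hne X hX)).ne')
  have hXg := g_pos X (hne X hX)
  set m := h X X / g X X with hm
  have hle : ∀ Y, m * g Y Y ≤ h Y Y := by
    intro Y
    by_cases hY : Y = 0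
    · simp [hY]
    have hYn : 0 < ‖Y‖ := norm_pos_iff.2 hY
    have hmem : (‖Y‖⁻¹ • Y) ∈ Metric.sphere (0 : V) 1 := by
      simp [norm_smul, hYn.ne']
    have h1 : m ≤ h (‖Y‖⁻¹ • Y) (‖Y‖⁻¹ • Y) / g (‖Y‖⁻¹ • Y) (‖Y‖⁻¹ • Y) := hmin hmem
    rw [le_div_iff₀ (g_pos _ (hne _ hmem))] at h1
    simp only [map_smul, LinearMap.smul_apply, smul_eq_mul] at h1
    have h2 : 0 < ‖Y‖⁻¹ * ‖Y‖⁻¹ := by positivity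
    refine le_of_mul_le_mul_left ?_ h2
    linarith
  refine ⟨m, X, hne X hX, fun Y => ?_, hle⟩
  have h0 : h X X = m * g X X := by rw [hm, div_mul_cancel₀ _ hXg.ne']
  -- `h - m g` is nonnegative and vanishes at `X`, so on the line `X + sY` it is a nonnegative
  -- quadratic without constant term. Its discriminant is the square of the linear coefficient,
  -- which must therefore vanish.
  have key : ∀ s : ℝ, 0 ≤ (h Y Y - m * g Y Y) * (s * s) + 2 * (h X Y - m * g X Y) * s + 0 := by
    intro s
    have := hle (X + s • Y)
    simp only [map_add, map_smul, LinearMap.add_apply, LinearMap.smul_apply, smul_eq_mul] at this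
    rw [h_symm Y X, g_symm Y X] at this
    linarith
  have hd := discrim_le_zero key
  rw [discrim] at hd
  have : (h X Y - m * g X Y) ^ 2 ≤ 0 := by linarith
  have := pow_eq_zero_iff (two_ne_zero) |>.1 (le_antisymm this (sq_nonneg _))
  linarith

lemma le_of_forall_relative_eigenvalue_ge (h g : LinearMap.BilinForm ℝ V)
    (h_symm : ∀ X Y, h X Y = h Y X) (g_symm : ∀ X Y, g X Y = g Y X)
    (g_pos : ∀ X, X ≠ 0 → 0 < g X X) {k : ℝ}
    (hk : ∀ m X, X ≠ 0 → (∀ Y, h X Y = m * g X Y) → k ≤ m) (Y : V) :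
    k * g Y Y ≤ h Y Y := by
  by_cases hY : Y = 0
  · simp [hY]
  have : Nontrivial V := ⟨Y, 0, hY⟩
  obtain ⟨m, X, hX, heq, hle⟩ := exists_min_relative_eigenvalue h g h_symm g_symm g_pos
  exact (mul_le_mul_of_nonneg_right (hk m X hX heq) (g_pos Y hY).le).trans (hle Y)

/-- Passing to `-h` negates the relative eigenvalues and reverses the bound. -/
lemma le_of_forall_relative_eigenvalue_le (h g : LinearMap.BilinForm ℝ V)
    (h_symm : ∀ X Y, h X Y = h Y X) (g_symm : ∀ X Y, g X Y = g Y X)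
    (g_pos : ∀ X, X ≠ 0 → 0 < g X X) {k : ℝ}
    (hk : ∀ m X, X ≠ 0 → (∀ Y, h X Y = m * g X Y) → m ≤ k) (Y : V) :
    h Y Y ≤ k * g Y Y := by
  have := le_of_forall_relative_eigenvalue_ge (-h) g (by simpa using h_symm) g_symm g_pos
    (k := -k) (fun m X hX heq => by
      have := hk (-m) X hX fun Y => by have := heq Y; simp at this; linarith
      linarith) Y
  simp at this
  linarith

end LinearMap.BilinForm

/-! ### The data `ψ` and `σ` in charts, and their smoothness. -/

namespace GaussianSpacetime

variable {n : ℕ} {S : Type*} [TopologicalSpace S]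
  [ChartedSpace (EuclideanSpace ℝ (Fin n)) S] [IsManifold (𝓡 n) ∞ S] {I : Set ℝ}

/-- The differential at `y` of the inverse of the preferred chart at `x₀`. -/
def chartDeriv (x₀ : S) (y : EuclideanSpace ℝ (Fin n)) :
    EuclideanSpace ℝ (Fin n) →L[ℝ] TangentSpace (𝓡 n) ((extChartAt (𝓡 n) x₀).symm y) :=
  mfderiv 𝓘(ℝ, EuclideanSpace ℝ (Fin n)) (𝓡 n) (extChartAt (𝓡 n) x₀).symm y

/-- The function `ψ` in the preferred chart at `x₀`. -/
def chartψ (N : GaussianSpacetime n S I) (x₀ : S) (q : ℝ × EuclideanSpace ℝ (Fin n)) : ℝ :=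
  N.ψ q.1 ((extChartAt (𝓡 n) x₀).symm q.2)

/-- The metrics `σ` in the preferred chart at `x₀`. -/
def chartσ (N : GaussianSpacetime n S I) (x₀ : S) (q : ℝ × EuclideanSpace ℝ (Fin n)) :
    EuclideanSpace ℝ (Fin n) →L[ℝ] EuclideanSpace ℝ (Fin n) →L[ℝ] ℝ :=
  let A : EuclideanSpace ℝ (Fin n) →L[ℝ] EuclideanSpace ℝ (Fin n) := chartDeriv x₀ q.2
  let B : EuclideanSpace ℝ (Fin n) →L[ℝ] EuclideanSpace ℝ (Fin n) →L[ℝ] ℝ :=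
    N.σ q.1 ((extChartAt (𝓡 n) x₀).symm q.2)
  B.bilinearComp A A

lemma chartσ_apply (N : GaussianSpacetime n S I) (x₀ : S) (q : ℝ × EuclideanSpace ℝ (Fin n))
    (ξ η : EuclideanSpace ℝ (Fin n)) :
    N.chartσ x₀ q ξ η = N.σ q.1 ((extChartAt (𝓡 n) x₀).symm q.2)
      (chartDeriv x₀ q.2 ξ) (chartDeriv x₀ q.2 η) := rfl

lemma coordMetric_eq (N : GaussianSpacetime n S I) (x₀ : S)
    (q V W : ℝ × EuclideanSpace ℝ (Fin n)) :
    N.coordMetric x₀ q V W =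
      Real.exp (2 * N.chartψ x₀ q) * (-(V.1 * W.1) + N.chartσ x₀ q V.2 W.2) := rfl

lemma isInvertible_chartDeriv (x₀ : S) {y : EuclideanSpace ℝ (Fin n)}
    (hy : y ∈ (extChartAt (𝓡 n) x₀).target) : (chartDeriv x₀ y).IsInvertible := by
  have := isInvertible_mfderivWithin_extChartAt_symm (I := 𝓡 n) hy
  rwa [show range (𝓡 n) = univ from ModelWithCorners.Boundaryless.range_eq_univ,
    mfderivWithin_univ] at this

lemma chartDeriv_self (x : S) (ξ : EuclideanSpace ℝ (Fin n)) :
    chartDeriv x (extChartAt (𝓡 n) x x) ξ = ξ := by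
  have := mfderivWithin_range_extChartAt_symm (I := 𝓡 n) (x := x)
  rw [show range (𝓡 n) = univ from ModelWithCorners.Boundaryless.range_eq_univ,
    mfderivWithin_univ] at this
  have h2 := congrArg (fun f => f ξ) this
  exact h2

lemma extChartAt_symm_contMDiffOn (x₀ : S) :
    ContMDiffOn (𝓘(ℝ, ℝ × EuclideanSpace ℝ (Fin n))) (𝓘(ℝ, ℝ).prod (𝓡 n)) ∞
      (fun q => (q.1, (extChartAt (𝓡 n) x₀).symm q.2)) (I ×ˢ (extChartAt (𝓡 n) x₀).target) := by
  refine ContMDiffOn.prodMk contDiff_fst.contMDiff.contMDiffOn ?_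
  exact (contMDiffOn_extChartAt_symm x₀).comp contDiff_snd.contMDiff.contMDiffOn
    fun q hq => hq.2

lemma contDiffOn_chartψ (N : GaussianSpacetime n S I) (x₀ : S) :
    ContDiffOn ℝ ∞ (N.chartψ x₀) (I ×ˢ (extChartAt (𝓡 n) x₀).target) := by
  rw [← contMDiffOn_iff_contDiffOn]
  exact N.smooth_ψ.comp (extChartAt_symm_contMDiffOn x₀) fun q hq => ⟨hq.1, mem_univ _⟩

/-- This is the tangent map of the inverse chart applied to the constant field `ξ`. As the chart
target is open, derivatives within it are ordinary derivatives. -/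
lemma contMDiffOn_chartDeriv (x₀ : S) (ξ : EuclideanSpace ℝ (Fin n)) :
    ContMDiffOn (𝓘(ℝ, ℝ × EuclideanSpace ℝ (Fin n))) ((𝓡 n).prod 𝓘(ℝ, EuclideanSpace ℝ (Fin n))) ∞
      (fun q => Bundle.TotalSpace.mk' (EuclideanSpace ℝ (Fin n))
        (E := fun x : S => TangentSpace (𝓡 n) x)
        ((extChartAt (𝓡 n) x₀).symm q.2) (chartDeriv x₀ q.2 ξ))
      (I ×ˢ (extChartAt (𝓡 n) x₀).target) := by
  have h1 := (contMDiffOn_extChartAt_symm (I := 𝓡 n) (n := ∞) x₀).contMDiffOn_tangentMapWithin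
    (m := ∞) (by simp) (isOpen_extChartAt_target x₀).uniqueMDiffOn
  have h2 : ContMDiffOn (𝓘(ℝ, ℝ × EuclideanSpace ℝ (Fin n)))
      (𝓘(ℝ, EuclideanSpace ℝ (Fin n)).tangent) ∞
      (fun q : ℝ × EuclideanSpace ℝ (Fin n) =>
        (⟨q.2, ξ⟩ : TangentBundle 𝓘(ℝ, EuclideanSpace ℝ (Fin n)) (EuclideanSpace ℝ (Fin n))))
      (I ×ˢ (extChartAt (𝓡 n) x₀).target) := by
    intro q hq
    rw [Bundle.contMDiffWithinAt_totalSpace]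
    refine ⟨contDiff_snd.contMDiff.contMDiffOn q hq, ?_⟩
    simp
    exact contMDiffWithinAt_const
  refine (h1.comp h2 fun q hq => hq.2).congr fun q hq => ?_
  simp only [Function.comp, tangentMapWithin]
  rw [mfderivWithin_of_isOpen (isOpen_extChartAt_target x₀) hq.2]
  rfl

lemma contDiffOn_chartσ (N : GaussianSpacetime n S I) (x₀ : S) :
    ContDiffOn ℝ ∞ (N.chartσ x₀) (I ×ˢ (extChartAt (𝓡 n) x₀).target) := by
  rw [contDiffOn_clm_apply]
  intro ξ
  rw [contDiffOn_clm_apply]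
  intro η
  rw [← contMDiffOn_iff_contDiffOn]
  have h1 := N.smooth_σ.comp (extChartAt_symm_contMDiffOn x₀) fun q hq => ⟨hq.1, mem_univ _⟩
  have h2 := ContMDiffOn.clm_bundle_apply₂ (F₁ := EuclideanSpace ℝ (Fin n))
    (F₂ := EuclideanSpace ℝ (Fin n)) (F₃ := ℝ)
    (E₁ := fun x : S => TangentSpace (𝓡 n) x) (E₂ := fun x : S => TangentSpace (𝓡 n) x)
    (E₃ := fun _ : S => ℝ) h1 (contMDiffOn_chartDeriv x₀ ξ) (contMDiffOn_chartDeriv x₀ η)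
  intro q hq
  have h3 := h2 q hq
  rw [Bundle.contMDiffWithinAt_totalSpace] at h3
  exact h3.2

end GaussianSpacetime

/-! ### Positive definite forms: coercivity and invertibility. -/

section
variable {V : Type*} [NormedAddCommGroup V] [InnerProductSpace ℝ V] [FiniteDimensional ℝ V]

lemma ContinuousLinearMap.exists_le_apply_self_of_pos (B : V →L[ℝ] V →L[ℝ] ℝ)
    (symm : ∀ X Y, B X Y = B Y X) (pos : ∀ X, X ≠ 0 → 0 < B X X) :
    ∃ c > 0, ∀ X, c * ‖X‖ ^ 2 ≤ B X X := by
  rcases subsingleton_or_nontrivial V with hV | hV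
  · exact ⟨1, one_pos, fun X => by simp [Subsingleton.elim X 0]⟩
  · let h : LinearMap.BilinForm ℝ V :=
      LinearMap.mk₂ ℝ (fun X Y => B X Y) (by simp) (by simp) (by simp) (by simp)
    obtain ⟨m, X, hX, heq, hle⟩ := h.exists_min_relative_eigenvalue (innerₗ V) symm
      (fun X Y => real_inner_comm _ _) fun X hX => real_inner_self_pos.2 hX
    have h1 : B X X = m * inner ℝ X X := heq X
    refine ⟨m, ?_, fun Y => ?_⟩
    · exact pos_of_mul_pos_left (h1 ▸ pos X hX) real_inner_self_nonneg
    · have h2 : m * inner ℝ Y Y ≤ B Y Y := hle Y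
      rwa [real_inner_self_eq_norm_sq] at h2

lemma ContinuousLinearMap.isInvertible_of_pos (B : V →L[ℝ] V →L[ℝ] ℝ)
    (pos : ∀ X, X ≠ 0 → 0 < B X X) : B.IsInvertible := by
  have hinj : Function.Injective B.toLinearMap := by
    rw [← LinearMap.ker_eq_bot, LinearMap.ker_eq_bot']
    intro X hX
    by_contra h
    have h1 := pos X h
    have h2 : B X = 0 := hX
    simp [h2] at h1
  have hfin : Module.finrank ℝ V = Module.finrank ℝ (V →L[ℝ] ℝ) := by
    rw [← (LinearMap.toContinuousLinearMap : (V →ₗ[ℝ] ℝ) ≃ₗ[ℝ] (V →L[ℝ] ℝ)).finrank_eq]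
    exact Subspace.dual_finrank_eq.symm
  refine ⟨(LinearEquiv.ofInjectiveOfFinrankEq B.toLinearMap hinj hfin).toContinuousLinearEquiv, ?_⟩
  ext X Y
  rfl
end

/-! ### First derivatives of `ψ` and `σ` in charts. -/

namespace GaussianSpacetime

variable {n : ℕ} {S : Type*} [TopologicalSpace S]
  [ChartedSpace (EuclideanSpace ℝ (Fin n)) S] [IsManifold (𝓡 n) ∞ S] {I : Set ℝ}

lemma chartσ_pos (N : GaussianSpacetime n S I) (x₀ : S) {q : ℝ × EuclideanSpace ℝ (Fin n)}
    (hq : q ∈ I ×ˢ (extChartAt (𝓡 n) x₀).target) (ξ : EuclideanSpace ℝ (Fin n)) (hξ : ξ ≠ 0) :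
    0 < N.chartσ x₀ q ξ ξ := by
  refine N.pos q.1 hq.1 _ _ fun h => hξ ?_
  exact (isInvertible_chartDeriv x₀ hq.2).injective (h.trans (map_zero _).symm)

lemma chartσ_symm (N : GaussianSpacetime n S I) (x₀ : S) {q : ℝ × EuclideanSpace ℝ (Fin n)}
    (hq : q.1 ∈ I) (ξ η : EuclideanSpace ℝ (Fin n)) :
    N.chartσ x₀ q ξ η = N.chartσ x₀ q η ξ :=
  N.symm q.1 hq _ _ _

lemma contDiffAt_chartσ (N : GaussianSpacetime n S I) (hI : IsOpen I) (x₀ : S)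
    {q : ℝ × EuclideanSpace ℝ (Fin n)} (hq : q ∈ I ×ˢ (extChartAt (𝓡 n) x₀).target) :
    ContDiffAt ℝ ∞ (N.chartσ x₀) q :=
  (N.contDiffOn_chartσ x₀).contDiffAt ((hI.prod (isOpen_extChartAt_target x₀)).mem_nhds hq)

lemma contDiffAt_chartψ (N : GaussianSpacetime n S I) (hI : IsOpen I) (x₀ : S)
    {q : ℝ × EuclideanSpace ℝ (Fin n)} (hq : q ∈ I ×ˢ (extChartAt (𝓡 n) x₀).target) :
    ContDiffAt ℝ ∞ (N.chartψ x₀) q :=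
  (N.contDiffOn_chartψ x₀).contDiffAt ((hI.prod (isOpen_extChartAt_target x₀)).mem_nhds hq)

lemma fderiv_chartψ_time (N : GaussianSpacetime n S I) (hI : IsOpen I) (x₀ : S)
    {t : ℝ} {y : EuclideanSpace ℝ (Fin n)} (ht : t ∈ I) (hy : y ∈ (extChartAt (𝓡 n) x₀).target) :
    fderiv ℝ (N.chartψ x₀) (t, y) (1, 0) =
      deriv (fun s => N.ψ s ((extChartAt (𝓡 n) x₀).symm y)) t := by
  have h := ((N.contDiffAt_chartψ hI x₀ (q := (t, y)) ⟨ht, hy⟩).differentiableAt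
    (by simp)).hasFDerivAt
  have h2 := h.comp_hasDerivAt t ((hasDerivAt_id t).prodMk (hasDerivAt_const t y))
  exact h2.deriv.symm

lemma fderiv_chartψ_space (N : GaussianSpacetime n S I) (hI : IsOpen I) (x₀ : S)
    {t : ℝ} {y : EuclideanSpace ℝ (Fin n)} (ht : t ∈ I) (hy : y ∈ (extChartAt (𝓡 n) x₀).target)
    (η : EuclideanSpace ℝ (Fin n)) :
    fderiv ℝ (N.chartψ x₀) (t, y) (0, η) =
      du (N.ψ t) ((extChartAt (𝓡 n) x₀).symm y) (chartDeriv x₀ y η) := by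
  have h := ((N.contDiffAt_chartψ hI x₀ (q := (t, y)) ⟨ht, hy⟩).differentiableAt
    (by simp)).hasFDerivAt
  have h2 := (h.comp y ((hasFDerivAt_const t y).prodMk (hasFDerivAt_id y))).fderiv
  have hψ : MDifferentiableAt (𝓡 n) 𝓘(ℝ, ℝ) (N.ψ t) ((extChartAt (𝓡 n) x₀).symm y) := by
    have h3 : ContMDiff (𝓡 n) 𝓘(ℝ, ℝ) ∞ (N.ψ t) := by
      rw [← contMDiffOn_univ]
      exact N.smooth_ψ.comp (contMDiffOn_const.prodMk contMDiffOn_id) fun x _ => ⟨ht, mem_univ _⟩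
    exact h3.mdifferentiableAt (by simp)
  have hφ : MDifferentiableAt 𝓘(ℝ, EuclideanSpace ℝ (Fin n)) (𝓡 n) (extChartAt (𝓡 n) x₀).symm y :=
    ((contMDiffOn_extChartAt_symm (I := 𝓡 n) (n := ∞) x₀).contMDiffAt
      ((isOpen_extChartAt_target x₀).mem_nhds hy)).mdifferentiableAt (by simp)
  have h4 := mfderiv_comp y hψ hφ
  rw [mfderiv_eq_fderiv] at h4
  have h5 := congrArg (fun f : EuclideanSpace ℝ (Fin n) →L[ℝ] ℝ => f η) (h2.symm.trans h4)
  exact h5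

lemma fderiv_chartσ_time (N : GaussianSpacetime n S I) (hI : IsOpen I) (x₀ : S)
    {t : ℝ} {y : EuclideanSpace ℝ (Fin n)} (ht : t ∈ I) (hy : y ∈ (extChartAt (𝓡 n) x₀).target)
    (ξ η : EuclideanSpace ℝ (Fin n)) :
    fderiv ℝ (N.chartσ x₀) (t, y) (1, 0) ξ η =
      deriv (fun s => N.σ s ((extChartAt (𝓡 n) x₀).symm y) (chartDeriv x₀ y ξ)
        (chartDeriv x₀ y η)) t := by
  have h := ((N.contDiffAt_chartσ hI x₀ (q := (t, y)) ⟨ht, hy⟩).differentiableAt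
    (by simp)).hasFDerivAt
  have h2 := h.comp_hasDerivAt t ((hasDerivAt_id t).prodMk (hasDerivAt_const t y))
  have h3 := (h2.clm_apply (hasDerivAt_const t ξ)).clm_apply (hasDerivAt_const t η)
  refine Eq.trans ?_ h3.deriv.symm
  simp

/-! ### Uniform bounds for the geometry over `[a, b]`. -/

/-- `C` bounds `e^ψ` and the first derivatives of `ψ` and `∂σ/∂x⁰` at `(t, x)`, relative to `σ`. -/
structure IsGeometryBound (N : GaussianSpacetime n S I) (C t : ℝ) (x : S) : Prop where
  exp_le : Real.exp (N.ψ t x) ≤ C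
  time_ψ : |deriv (fun s => N.ψ s x) t| ≤ C
  space_ψ : ∀ X : TangentSpace (𝓡 n) x, N.σ t x X X ≤ 1 →
    |du (N.ψ t) x X| ≤ C
  time_σ : ∀ X : TangentSpace (𝓡 n) x, |deriv (fun s => N.σ s x X X) t| ≤ C * N.σ t x X X

lemma IsGeometryBound.mono {N : GaussianSpacetime n S I} {C C' t : ℝ} {x : S} (ht : t ∈ I)
    (h : N.IsGeometryBound C t x) (hC : C ≤ C') : N.IsGeometryBound C' t x where
  exp_le := h.exp_le.trans hC
  time_ψ := h.time_ψ.trans hC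
  space_ψ X hX := (h.space_ψ X hX).trans hC
  time_σ X := (h.time_σ X).trans <| mul_le_mul_of_nonneg_right hC <| by
    by_cases hX : X = 0
    · simp [hX]
    · exact (N.pos t ht x X hX).le

/-- In a fixed chart, continuity bounds the first derivatives in operator norm and keeps `σ`
coercive. Coercivity converts Euclidean bounds into bounds relative to `σ`. -/
lemma eventually_isGeometryBound (N : GaussianSpacetime n S I) (hI : IsOpen I) {t₀ : ℝ}
    (ht₀ : t₀ ∈ I) (x₀ : S) :
    ∃ C, ∀ᶠ p in 𝓝 (t₀, x₀), N.IsGeometryBound C p.1 p.2 := by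
  set q₀ : ℝ × EuclideanSpace ℝ (Fin n) := (t₀, extChartAt (𝓡 n) x₀ x₀)
  have hq₀ : q₀ ∈ I ×ˢ (extChartAt (𝓡 n) x₀).target := ⟨ht₀, mem_extChartAt_target x₀⟩
  have hσ := N.contDiffAt_chartσ hI x₀ hq₀
  have hψ := N.contDiffAt_chartψ hI x₀ hq₀
  obtain ⟨c, hc, hcle⟩ := (N.chartσ x₀ q₀).exists_le_apply_self_of_pos
    (N.chartσ_symm x₀ hq₀.1) (N.chartσ_pos x₀ hq₀)
  set C₁ := ‖fderiv ℝ (N.chartσ x₀) q₀‖ + 1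
  set C₂ := ‖fderiv ℝ (N.chartψ x₀) q₀‖ + 1
  have e1 : ∀ᶠ q in 𝓝 q₀, ‖N.chartσ x₀ q - N.chartσ x₀ q₀‖ < c / 2 := by
    have := (hσ.continuousAt.sub continuousAt_const).norm
      (f := fun q => N.chartσ x₀ q - N.chartσ x₀ q₀)
    exact this.eventually_lt continuousAt_const (by simpa using hc)
  have e2 : ∀ᶠ q in 𝓝 q₀, ‖fderiv ℝ (N.chartσ x₀) q‖ < C₁ :=
    (hσ.fderiv_right (m := 0) (by simp)).continuousAt.norm.eventually_lt continuousAt_const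
      (lt_add_one _)
  have e3 : ∀ᶠ q in 𝓝 q₀, ‖fderiv ℝ (N.chartψ x₀) q‖ < C₂ :=
    (hψ.fderiv_right (m := 0) (by simp)).continuousAt.norm.eventually_lt continuousAt_const
      (lt_add_one _)
  have e4 : ∀ᶠ q in 𝓝 q₀, Real.exp (N.chartψ x₀ q) < Real.exp (N.chartψ x₀ q₀) + 1 :=
    hψ.continuousAt.rexp.eventually_lt continuousAt_const (lt_add_one _)
  have e5 := (hI.prod (isOpen_extChartAt_target x₀)).mem_nhds hq₀
  have hcont : ContinuousAt (fun p : ℝ × S => (p.1, extChartAt (𝓡 n) x₀ p.2)) (t₀, x₀) :=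
    continuousAt_fst.prodMk ((continuousAt_extChartAt (I := 𝓡 n) x₀).comp continuousAt_snd)
  have e6 : ∀ᶠ p in 𝓝 (t₀, x₀), p.2 ∈ (extChartAt (𝓡 n) x₀).source :=
    continuousAt_snd.eventually (extChartAt_source_mem_nhds (I := 𝓡 n) x₀)
  have hC₁ : 0 < C₁ := by positivity
  have hC₂ : 0 < C₂ := by positivity
  -- The sum of the four separate bounds; each estimate below uses one summand or group.
  refine ⟨Real.exp (N.chartψ x₀ q₀) + 1 + C₂ + C₂ * (1 + 2 / c) + C₁ * (2 / c), ?_⟩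
  filter_upwards [hcont.eventually e1, hcont.eventually e2, hcont.eventually e3,
    hcont.eventually e4, hcont.eventually e5, e6] with ⟨t, x⟩ h1 h2 h3 h4 h5 h6
  obtain ⟨y, rfl, hy⟩ : ∃ y, (extChartAt (𝓡 n) x₀).symm y = x ∧ extChartAt (𝓡 n) x₀ x = y :=
    ⟨_, (extChartAt (𝓡 n) x₀).left_inv h6, rfl⟩
  simp only [hy] at h1 h2 h3 h4 h5
  have ht : t ∈ I := h5.1
  have hyt : y ∈ (extChartAt (𝓡 n) x₀).target := h5.2
  -- `σ` is at least `c` at `q₀` and has moved by less than `c / 2`, so it is still at least `c /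
  -- 2`.
  have hlow : ∀ ξ, ‖ξ‖ ^ 2 ≤ 2 / c * N.chartσ x₀ (t, y) ξ ξ := by
    intro ξ
    have g1 := hcle ξ
    have g2 : |(N.chartσ x₀ (t, y) - N.chartσ x₀ q₀) ξ ξ| ≤ c / 2 * ‖ξ‖ * ‖ξ‖ := by
      rw [← Real.norm_eq_abs]
      exact (ContinuousLinearMap.le_opNorm₂ _ ξ ξ).trans (by gcongr)
    have g3 := (abs_le.1 g2).1
    simp only [sub_apply] at g3
    rw [div_mul_eq_mul_div, le_div_iff₀ hc]
    linarith
  have hσ0 : ∀ ξ, 0 ≤ N.chartσ x₀ (t, y) ξ ξ := fun ξ => by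
    have g1 := hlow ξ
    have g2 : 0 < 2 / c := by positivity
    exact nonneg_of_mul_nonneg_right ((sq_nonneg _).trans g1) g2
  have hE := Real.exp_pos (N.chartψ x₀ q₀)
  have hp1 : 0 < C₂ * (1 + 2 / c) := by positivity
  have hp2 : 0 < C₁ * (2 / c) := by positivity
  refine ⟨?_, ?_, fun X hX => ?_, fun X => ?_⟩
  · refine (show Real.exp (N.ψ t _) ≤ Real.exp (N.chartψ x₀ q₀) + 1 from h4.le).trans ?_
    linarith
  · rw [← N.fderiv_chartψ_time hI x₀ ht hyt]
    have g1 := (fderiv ℝ (N.chartψ x₀) (t, y)).le_opNorm (1, 0)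
    have g2 : ‖((1, 0) : ℝ × EuclideanSpace ℝ (Fin n))‖ = 1 := by simp [Prod.norm_def]
    rw [g2, mul_one, Real.norm_eq_abs] at g1
    linarith
  · obtain ⟨ξ, rfl⟩ := (isInvertible_chartDeriv x₀ hyt).surjective X
    rw [← N.fderiv_chartψ_space hI x₀ ht hyt]
    have g1 := (fderiv ℝ (N.chartψ x₀) (t, y)).le_opNorm (0, ξ)
    have g2 : ‖((0, ξ) : ℝ × EuclideanSpace ℝ (Fin n))‖ = ‖ξ‖ := by simp [Prod.norm_def]
    rw [g2, Real.norm_eq_abs] at g1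
    have g3 : ‖ξ‖ ^ 2 ≤ 2 / c := (hlow ξ).trans
      (mul_le_of_le_one_right (by positivity) hX)
    have g4 : ‖ξ‖ ≤ 1 + 2 / c := by nlinarith [sq_nonneg (‖ξ‖ - 1)]
    have g5 : ‖fderiv ℝ (N.chartψ x₀) (t, y)‖ * ‖ξ‖ ≤ C₂ * (1 + 2 / c) := by gcongr
    linarith
  · obtain ⟨ξ, rfl⟩ := (isInvertible_chartDeriv x₀ hyt).surjective X
    rw [← N.fderiv_chartσ_time hI x₀ ht hyt, ← N.chartσ_apply x₀ (t, y)]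
    have g1 := ((fderiv ℝ (N.chartσ x₀) (t, y)) (1, 0)).le_opNorm₂ ξ ξ
    have g1' := (fderiv ℝ (N.chartσ x₀) (t, y)).le_opNorm (1, 0)
    have g2 : ‖((1, 0) : ℝ × EuclideanSpace ℝ (Fin n))‖ = 1 := by simp [Prod.norm_def]
    rw [g2, mul_one] at g1'
    rw [Real.norm_eq_abs] at g1
    have g3 : ‖(fderiv ℝ (N.chartσ x₀) (t, y)) (1, 0)‖ * ‖ξ‖ * ‖ξ‖ ≤ C₁ * ‖ξ‖ ^ 2 := by
      rw [mul_assoc, ← sq]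
      gcongr
      exact g1'.trans h2.le
    have g4 : C₁ * ‖ξ‖ ^ 2 ≤ C₁ * (2 / c) * N.chartσ x₀ (t, y) ξ ξ := by
      rw [mul_assoc]
      gcongr
      exact hlow ξ
    refine (g1.trans (g3.trans g4)).trans ?_
    refine mul_le_mul_of_nonneg_right ?_ (hσ0 ξ)
    linarith

lemma exists_isGeometryBound [CompactSpace S] (N : GaussianSpacetime n S I) (hI : IsOpen I)
    {a b : ℝ} (hab : Icc a b ⊆ I) :
    ∃ C, ∀ t ∈ Icc a b, ∀ x, N.IsGeometryBound C t x := by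
  have hK : IsCompact (Icc a b ×ˢ (univ : Set S)) := isCompact_Icc.prod isCompact_univ
  -- Membership in `I` is carried along because enlarging `C` requires `σ ≥ 0`.
  have : ∃ C, ∀ p ∈ Icc a b ×ˢ (univ : Set S), p.1 ∈ I ∧ N.IsGeometryBound C p.1 p.2 := by
    refine hK.induction_on (p := fun s => ∃ C, ∀ p ∈ s, p.1 ∈ I ∧ N.IsGeometryBound C p.1 p.2)
      ⟨0, by simp⟩ ?_ ?_ ?_
    · rintro s t hst ⟨C, hC⟩
      exact ⟨C, fun p hp => hC p (hst hp)⟩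
    · rintro s t ⟨C, hC⟩ ⟨C', hC'⟩
      refine ⟨max C C', ?_⟩
      rintro p (hp | hp)
      · exact ⟨(hC p hp).1, (hC p hp).2.mono (hC p hp).1 (le_max_left _ _)⟩
      · exact ⟨(hC' p hp).1, (hC' p hp).2.mono (hC' p hp).1 (le_max_right _ _)⟩
    · rintro ⟨t, x⟩ hp
      obtain ⟨C, hC⟩ := N.eventually_isGeometryBound hI (hab hp.1) x
      have hI' : ∀ᶠ p in 𝓝 (t, x), p.1 ∈ I :=
        continuousAt_fst.eventually (hI.mem_nhds (hab hp.1))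
      exact ⟨_, mem_nhdsWithin_of_mem_nhds (hI'.and hC), C, fun p hp => hp⟩
  obtain ⟨C, hC⟩ := this
  exact ⟨C, fun t ht x => (hC (t, x) ⟨ht, mem_univ _⟩).2⟩

/-! ### The gradient, the spacelike condition and the unit normal. -/

/-- The gradient `u^i = σ^{ij}(u, x) u_j`. -/
def grad (N : GaussianSpacetime n S I) (u : S → ℝ) (x : S) : TangentSpace (𝓡 n) x :=
  (N.σ (u x) x).inverse (du u x)

lemma isInvertible_σ (N : GaussianSpacetime n S I) {t : ℝ} (ht : t ∈ I) (x : S) :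
    (N.σ t x).IsInvertible := by
  let B : EuclideanSpace ℝ (Fin n) →L[ℝ] EuclideanSpace ℝ (Fin n) →L[ℝ] ℝ := N.σ t x
  exact ContinuousLinearMap.isInvertible_of_pos B (N.pos t ht x)

lemma σ_grad (N : GaussianSpacetime n S I) {u : S → ℝ} {x : S} (hu : u x ∈ I) :
    N.σ (u x) x (N.grad u x) = du u x :=
  (N.isInvertible_σ hu x).self_apply_inverse _

lemma gradSq_eq_du (N : GaussianSpacetime n S I) (u : S → ℝ) (x : S) :
    N.gradSq u x = du u x (N.grad u x) := rfl

lemma gradSq_eq_σ (N : GaussianSpacetime n S I) {u : S → ℝ} {x : S} (hu : u x ∈ I) :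
    N.gradSq u x = N.σ (u x) x (N.grad u x) (N.grad u x) := by
  rw [σ_grad N hu, gradSq_eq_du]

/-- Expand `σ(∇u - Z, ∇u - Z) ≥ 0`. The left side is a lower barrier for `|Du|²`, sharp at `Z = ∇u`,
and contains no inverse of `σ` that would have to be differentiated. -/
lemma le_gradSq (N : GaussianSpacetime n S I) {u : S → ℝ} {x : S} (hu : u x ∈ I)
    (Z : TangentSpace (𝓡 n) x) : 2 * du u x Z - N.σ (u x) x Z Z ≤ N.gradSq u x := by
  have h : 0 ≤ N.σ (u x) x (N.grad u x - Z) (N.grad u x - Z) := by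
    by_cases h0 : N.grad u x - Z = 0
    · simp [h0]
    · exact (N.pos _ hu x _ h0).le
  simp only [map_sub, sub_apply] at h
  rw [N.symm _ hu x Z (N.grad u x), σ_grad N hu, ← gradSq_eq_du] at h
  linarith

lemma gradSq_pos (N : GaussianSpacetime n S I) {u : S → ℝ} {x : S} (hu : u x ∈ I)
    (h : N.grad u x ≠ 0) : 0 < N.gradSq u x := by
  rw [gradSq_eq_σ N hu]
  exact N.pos _ hu x _ h

lemma inducedMetric_eq (N : GaussianSpacetime n S I) (u : S → ℝ) (x : S)
    (X Y : TangentSpace (𝓡 n) x) :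
    N.inducedMetric u x X Y =
      Real.exp (2 * N.ψ (u x) x) * (-(du u x X * du u x Y) + N.σ (u x) x X Y) := rfl

lemma inducedMetric_grad (N : GaussianSpacetime n S I) {u : S → ℝ} {x : S} (hu : u x ∈ I) :
    N.inducedMetric u x (N.grad u x) (N.grad u x) =
      Real.exp (2 * N.ψ (u x) x) * (N.gradSq u x * (1 - N.gradSq u x)) := by
  rw [inducedMetric_eq, ← gradSq_eq_σ N hu, ← gradSq_eq_du]
  ring

/-- Test the induced metric on the gradient: `e^{2ψ} G (1 - G) > 0`. -/
lemma IsSpacelikeGraph.gradSq_lt_one {N : GaussianSpacetime n S I} {u : S → ℝ}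
    (h : N.IsSpacelikeGraph u) {x : S} (hu : u x ∈ I) : N.gradSq u x < 1 := by
  by_cases h0 : N.grad u x = 0
  · simp [gradSq_eq_du, h0]
  · have h1 := h x _ h0
    rw [inducedMetric_grad N hu] at h1
    have h2 := pos_of_mul_pos_right h1 (Real.exp_pos _).le
    have h3 := pos_of_mul_pos_right h2 (gradSq_pos N hu h0).le
    linarith

/-- The past directed unit normal of the graph. -/
def pastNormal (N : GaussianSpacetime n S I) (u : S → ℝ) (x : S) : ℝ × TangentSpace (𝓡 n) x :=
  (-(N.vTilde u x * Real.exp (-N.ψ (u x) x))) • ((1 : ℝ), N.grad u x)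

lemma isPastNormal_pastNormal (N : GaussianSpacetime n S I) {u : S → ℝ} {x : S} (hu : u x ∈ I)
    (h : N.gradSq u x < 1) : N.IsPastNormal u x (N.pastNormal u x) := by
  have hv : 0 < N.vTilde u x := by
    have : 0 < √(1 - N.gradSq u x) := Real.sqrt_pos.2 (by linarith)
    simp only [vTilde]
    positivity
  refine ⟨fun X => ?_, ?_, ?_⟩
  · simp [metric, graphPush, pastNormal, σ_grad N hu]
  · simp only [metric, pastNormal, Prod.smul_mk, map_smul, smul_apply, smul_eq_mul,
      ← gradSq_eq_σ N hu]
    have h1 : Real.exp (2 * N.ψ (u x) x) * (Real.exp (-N.ψ (u x) x)) ^ 2 = 1 := by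
      rw [← Real.exp_nat_mul, ← Real.exp_add]
      simp
    have h2 : N.vTilde u x ^ 2 * (1 - N.gradSq u x) = 1 := by
      rw [vTilde, div_pow, Real.sq_sqrt (by linarith)]
      field_simp [(by linarith : (1 - N.gradSq u x) ≠ 0)]
    linear_combination (-(N.vTilde u x ^ 2 * (1 - N.gradSq u x))) * h1 - h2
  · simp only [pastNormal, Prod.smul_mk, smul_eq_mul, mul_one, neg_lt_zero]
    positivity

/-! ### The function `u` in charts and continuity of `|Du|²`. -/

/-- The function `u` in the preferred chart at `x₀`. -/
def chartFun (u : S → ℝ) (x₀ : S) (y : EuclideanSpace ℝ (Fin n)) : ℝ :=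
  u ((extChartAt (𝓡 n) x₀).symm y)

lemma contDiffAt_chartFun {u : S → ℝ} (hu : ContMDiff (𝓡 n) 𝓘(ℝ, ℝ) 2 u) (x₀ : S)
    {y : EuclideanSpace ℝ (Fin n)} (hy : y ∈ (extChartAt (𝓡 n) x₀).target) :
    ContDiffAt ℝ 2 (chartFun u x₀) y := by
  have h1 : ContMDiffAt 𝓘(ℝ, EuclideanSpace ℝ (Fin n)) (𝓡 n) 2 (extChartAt (𝓡 n) x₀).symm y :=
    ((contMDiffOn_extChartAt_symm (I := 𝓡 n) (n := ∞) x₀).contMDiffAt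
      ((isOpen_extChartAt_target x₀).mem_nhds hy)).of_le (WithTop.coe_le_coe.2 le_top)
  exact (hu.contMDiffAt.comp y h1).contDiffAt

lemma fderiv_chartFun {u : S → ℝ} (hu : ContMDiff (𝓡 n) 𝓘(ℝ, ℝ) 2 u) (x₀ : S)
    {y : EuclideanSpace ℝ (Fin n)} (hy : y ∈ (extChartAt (𝓡 n) x₀).target)
    (η : EuclideanSpace ℝ (Fin n)) :
    fderiv ℝ (chartFun u x₀) y η =
      du u ((extChartAt (𝓡 n) x₀).symm y) (chartDeriv x₀ y η) := by
  have hφ : MDifferentiableAt 𝓘(ℝ, EuclideanSpace ℝ (Fin n)) (𝓡 n) (extChartAt (𝓡 n) x₀).symm y :=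
    ((contMDiffOn_extChartAt_symm (I := 𝓡 n) (n := ∞) x₀).contMDiffAt
      ((isOpen_extChartAt_target x₀).mem_nhds hy)).mdifferentiableAt (by simp)
  have h4 := mfderiv_comp y (hu.mdifferentiableAt (by simp)) hφ
  rw [mfderiv_eq_fderiv] at h4
  exact congrArg (fun f : EuclideanSpace ℝ (Fin n) →L[ℝ] ℝ => f η) h4

lemma gradSq_chart (N : GaussianSpacetime n S I) {u : S → ℝ}
    (hu : ContMDiff (𝓡 n) 𝓘(ℝ, ℝ) 2 u) (huI : ∀ x, u x ∈ I) (x₀ : S)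
    {y : EuclideanSpace ℝ (Fin n)} (hy : y ∈ (extChartAt (𝓡 n) x₀).target) :
    N.gradSq u ((extChartAt (𝓡 n) x₀).symm y) =
      fderiv ℝ (chartFun u x₀) y ((N.chartσ x₀ (chartFun u x₀ y, y)).inverse
        (fderiv ℝ (chartFun u x₀) y)) := by
  have hq : (chartFun u x₀ y, y) ∈ I ×ˢ (extChartAt (𝓡 n) x₀).target := ⟨huI _, hy⟩
  set ξ := (N.chartσ x₀ (chartFun u x₀ y, y)).inverse (fderiv ℝ (chartFun u x₀) y) with hξ
  have hinv := ContinuousLinearMap.isInvertible_of_pos _ (N.chartσ_pos x₀ hq)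
  have h1 : N.chartσ x₀ (chartFun u x₀ y, y) ξ = fderiv ℝ (chartFun u x₀) y :=
    hinv.self_apply_inverse _
  have h2 : N.σ (u ((extChartAt (𝓡 n) x₀).symm y)) _ (chartDeriv x₀ y ξ) =
      du u ((extChartAt (𝓡 n) x₀).symm y) := by
    ext X
    obtain ⟨η, rfl⟩ := (isInvertible_chartDeriv x₀ hy).surjective X
    rw [← fderiv_chartFun hu x₀ hy, ← h1]
    rfl
  have h3 : N.grad u ((extChartAt (𝓡 n) x₀).symm y) = chartDeriv x₀ y ξ := by
    rw [grad, ← h2, (N.isInvertible_σ (huI _) _).inverse_apply_self]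
  rw [gradSq_eq_du, h3, ← fderiv_chartFun hu x₀ hy]

lemma continuous_gradSq (N : GaussianSpacetime n S I) (hI : IsOpen I) {u : S → ℝ}
    (hu : ContMDiff (𝓡 n) 𝓘(ℝ, ℝ) 2 u) (huI : ∀ x, u x ∈ I) :
    Continuous (N.gradSq u) := by
  rw [continuous_iff_continuousAt]
  intro x₀
  set y₀ := extChartAt (𝓡 n) x₀ x₀
  have hy₀ : y₀ ∈ (extChartAt (𝓡 n) x₀).target := mem_extChartAt_target x₀
  have hq : (chartFun u x₀ y₀, y₀) ∈ I ×ˢ (extChartAt (𝓡 n) x₀).target := ⟨huI _, hy₀⟩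
  have hũ := contDiffAt_chartFun hu x₀ hy₀
  have hD : ContinuousAt (fderiv ℝ (chartFun u x₀)) y₀ :=
    (hũ.fderiv_right (m := 1) (by norm_num)).continuousAt
  have hs : ContinuousAt (fun y => N.chartσ x₀ (chartFun u x₀ y, y)) y₀ :=
    ContinuousAt.comp (g := N.chartσ x₀) (f := fun y => (chartFun u x₀ y, y))
      (N.contDiffAt_chartσ hI x₀ hq).continuousAt (hũ.continuousAt.prodMk continuousAt_id)
  have hinv := ContinuousLinearMap.isInvertible_of_pos _ (N.chartσ_pos x₀ hq)
  have hsi : ContinuousAt (fun y => (N.chartσ x₀ (chartFun u x₀ y, y)).inverse) y₀ :=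
    ContinuousAt.comp (g := ContinuousLinearMap.inverse)
      (f := fun y => N.chartσ x₀ (chartFun u x₀ y, y))
      (hinv.contDiffAt_map_inverse (n := 0)).continuousAt hs
  have hG := hD.clm_apply (hsi.clm_apply hD)
  have hG' := ContinuousAt.comp (x := x₀) (f := extChartAt (𝓡 n) x₀) hG
    (continuousAt_extChartAt (I := 𝓡 n) x₀)
  refine hG'.congr ?_
  filter_upwards [extChartAt_source_mem_nhds (I := 𝓡 n) x₀] with x hx
  have := N.gradSq_chart hu huI x₀ ((extChartAt (𝓡 n) x₀).map_source hx)
  rw [(extChartAt (𝓡 n) x₀).left_inv hx] at this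
  exact this.symm

/-! ### The second fundamental form in coordinates. -/

lemma fderiv_coordMetric (N : GaussianSpacetime n S I) (hI : IsOpen I) (x₀ : S)
    {q : ℝ × EuclideanSpace ℝ (Fin n)} (hq : q ∈ I ×ˢ (extChartAt (𝓡 n) x₀).target)
    (V W Z : ℝ × EuclideanSpace ℝ (Fin n)) :
    fderiv ℝ (fun p => N.coordMetric x₀ p V W) q Z =
      Real.exp (2 * N.chartψ x₀ q) * (2 * fderiv ℝ (N.chartψ x₀) q Z *
        (-(V.1 * W.1) + N.chartσ x₀ q V.2 W.2) + fderiv ℝ (N.chartσ x₀) q Z V.2 W.2) := by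
  have hψ := ((N.contDiffAt_chartψ hI x₀ hq).differentiableAt (by simp)).hasFDerivAt
  have hσ := ((N.contDiffAt_chartσ hI x₀ hq).differentiableAt (by simp)).hasFDerivAt
  have h1 := (hψ.const_mul 2).exp
  have h2 := ((hσ.clm_apply (hasFDerivAt_const V.2 q)).clm_apply
    (hasFDerivAt_const W.2 q)).const_add (-(V.1 * W.1))
  have h3 := (h1.mul h2).fderiv
  have h4 : (fun p => N.coordMetric x₀ p V W) = (fun p => Real.exp (2 * N.chartψ x₀ p)) *
      fun p => -(V.1 * W.1) + N.chartσ x₀ p V.2 W.2 := rfl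
  rw [h4, h3]
  simp
  ring

/-- The differential of the graph embedding in the preferred chart at `x₀`. -/
def chartPush (u : S → ℝ) (x₀ : S) (y : EuclideanSpace ℝ (Fin n)) :
    EuclideanSpace ℝ (Fin n) →L[ℝ] ℝ × EuclideanSpace ℝ (Fin n) :=
  (fderiv ℝ (chartFun u x₀) y).prod (ContinuousLinearMap.id ℝ _)

lemma fderiv_coordGraph {u : S → ℝ} (hu : ContMDiff (𝓡 n) 𝓘(ℝ, ℝ) 2 u) (x₀ : S)
    {y : EuclideanSpace ℝ (Fin n)} (hy : y ∈ (extChartAt (𝓡 n) x₀).target) :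
    fderiv ℝ (coordGraph u x₀) y = chartPush u x₀ y :=
  ((((contDiffAt_chartFun hu x₀ hy).differentiableAt (by simp)).hasFDerivAt).prodMk
    (hasFDerivAt_id y)).fderiv

lemma fderiv_fderiv_coordGraph {u : S → ℝ} (hu : ContMDiff (𝓡 n) 𝓘(ℝ, ℝ) 2 u) (x₀ : S)
    {y : EuclideanSpace ℝ (Fin n)} (hy : y ∈ (extChartAt (𝓡 n) x₀).target)
    (X Y : EuclideanSpace ℝ (Fin n)) :
    fderiv ℝ (fun y => fderiv ℝ (coordGraph u x₀) y Y) y X =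
      (fderiv ℝ (fderiv ℝ (chartFun u x₀)) y X Y, 0) := by
  have h1 : (fun y => fderiv ℝ (coordGraph u x₀) y Y) =ᶠ[𝓝 y]
      fun y => (fderiv ℝ (chartFun u x₀) y Y, Y) := by
    filter_upwards [(isOpen_extChartAt_target x₀).mem_nhds hy] with z hz
    rw [fderiv_coordGraph hu x₀ hz]
    rfl
  have h2 := (((contDiffAt_chartFun hu x₀ hy).fderiv_right (m := 1)
    (by norm_num)).differentiableAt (by simp)).hasFDerivAt
  have h3 := ((h2.clm_apply (hasFDerivAt_const Y y)).prodMk (hasFDerivAt_const Y y)).fderiv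
  rw [h1.fderiv_eq, h3]
  simp

/-- The point of the graph over `x` in the preferred chart at `x`. -/
def graphPoint (u : S → ℝ) (x : S) : ℝ × EuclideanSpace ℝ (Fin n) :=
  (u x, extChartAt (𝓡 n) x x)

lemma coordGraph_self (u : S → ℝ) (x : S) :
    coordGraph u x (extChartAt (𝓡 n) x x) = graphPoint u x := by
  simp [coordGraph, graphPoint]

lemma graphPoint_mem {u : S → ℝ} {x : S} (hu : u x ∈ I) :
    graphPoint u x ∈ I ×ˢ (extChartAt (𝓡 n) x).target :=
  ⟨hu, mem_extChartAt_target x⟩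

lemma chartψ_self (N : GaussianSpacetime n S I) (u : S → ℝ) (x : S) :
    N.chartψ x (graphPoint u x) = N.ψ (u x) x := by
  simp [chartψ, graphPoint]

/-- The inverse chart at `x` has identity differential at the centre. Its value there equals `x`
only propositionally, hence the generalisation over `z`. -/
lemma chartσ_self (N : GaussianSpacetime n S I) (u : S → ℝ) (x : S)
    (X Y : EuclideanSpace ℝ (Fin n)) :
    N.chartσ x (graphPoint u x) X Y = N.σ (u x) x X Y := by
  have h : ∀ z, z = x → ∀ ξ η : EuclideanSpace ℝ (Fin n),
      N.σ (u x) z ξ η = N.σ (u x) x ξ η := by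
    rintro _ rfl _ _
    rfl
  have h1 := h _ ((extChartAt (𝓡 n) x).left_inv (mem_extChartAt_source x)) X Y
  exact (congrArg₂ (fun ξ η : EuclideanSpace ℝ (Fin n) => N.σ (u x)
    ((extChartAt (𝓡 n) x).symm (extChartAt (𝓡 n) x x)) ξ η)
    (chartDeriv_self x X) (chartDeriv_self x Y)).trans h1

lemma fderiv_chartσ_time_self (N : GaussianSpacetime n S I) (hI : IsOpen I) {u : S → ℝ} {x : S}
    (hu : u x ∈ I) (X : TangentSpace (𝓡 n) x) :
    fderiv ℝ (N.chartσ x) (graphPoint u x) (1, 0) X X =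
      deriv (fun s => N.σ s x X X) (u x) := by
  have h1 := N.fderiv_chartσ_time hI x hu (mem_extChartAt_target x) X X
  rw [graphPoint, h1]
  congr 1
  funext s
  -- The constant function `s` places the graph point at an arbitrary time.
  exact N.chartσ_self (fun _ => s) x X X

lemma fderiv_chartψ_time_self (N : GaussianSpacetime n S I) (hI : IsOpen I) {u : S → ℝ} {x : S}
    (hu : u x ∈ I) :
    fderiv ℝ (N.chartψ x) (graphPoint u x) (1, 0) = deriv (fun s => N.ψ s x) (u x) := by
  have h1 := N.fderiv_chartψ_time hI x hu (mem_extChartAt_target x)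
  rw [graphPoint, h1, (extChartAt (𝓡 n) x).left_inv (mem_extChartAt_source x)]

lemma du_self (f : S → ℝ) (x : S) (ξ : EuclideanSpace ℝ (Fin n)) :
    (du f ((extChartAt (𝓡 n) x).symm (extChartAt (𝓡 n) x x)))
      (chartDeriv x (extChartAt (𝓡 n) x x) ξ) = du f x ξ := by
  have h : ∀ z, z = x → du f z ξ = du f x ξ := by
    rintro _ rfl
    rfl
  rw [← h _ ((extChartAt (𝓡 n) x).left_inv (mem_extChartAt_source x))]
  erw [chartDeriv_self]

lemma fderiv_chartψ_space_self (N : GaussianSpacetime n S I) (hI : IsOpen I) {u : S → ℝ} {x : S}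
    (hu : u x ∈ I) (X : EuclideanSpace ℝ (Fin n)) :
    fderiv ℝ (N.chartψ x) (graphPoint u x) (0, X) = du (N.ψ (u x)) x X := by
  rw [graphPoint, N.fderiv_chartψ_space hI x hu (mem_extChartAt_target x), du_self]

lemma fderiv_chartFun_self {u : S → ℝ} (hu : ContMDiff (𝓡 n) 𝓘(ℝ, ℝ) 2 u) (x : S)
    (X : EuclideanSpace ℝ (Fin n)) :
    fderiv ℝ (chartFun u x) (extChartAt (𝓡 n) x x) X = du u x X := by
  rw [fderiv_chartFun hu x (mem_extChartAt_target x), du_self]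

/-- Only the time component of the graph map has a second derivative. `T Z V W` is the derivative of
the metric along `Z` without its factor `e^{2ψ}`. -/
lemma secondFundamentalForm_eq (N : GaussianSpacetime n S I) (hI : IsOpen I) {u : S → ℝ}
    (hu : ContMDiff (𝓡 n) 𝓘(ℝ, ℝ) 2 u) {x : S} (hx : u x ∈ I)
    (ν : ℝ × EuclideanSpace ℝ (Fin n)) (X Y : EuclideanSpace ℝ (Fin n)) :
    let J := chartPush u x (extChartAt (𝓡 n) x x)
    let T := fun Z V W : ℝ × EuclideanSpace ℝ (Fin n) =>
      2 * fderiv ℝ (N.chartψ x) (graphPoint u x) Z *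
        (-(V.1 * W.1) + N.chartσ x (graphPoint u x) V.2 W.2) +
      fderiv ℝ (N.chartσ x) (graphPoint u x) Z V.2 W.2
    N.secondFundamentalForm u x ν X Y = Real.exp (2 * N.ψ (u x) x) *
      (fderiv ℝ (fderiv ℝ (chartFun u x)) (extChartAt (𝓡 n) x x) X Y * ν.1 -
        1 / 2 * (T (J X) (J Y) ν + T (J Y) (J X) ν - T ν (J X) (J Y))) := by
  intro J T
  have hy := mem_extChartAt_target (I := 𝓡 n) x
  have h1 : N.secondFundamentalForm u x ν X Y =
      -(N.coordMetric x (coordGraph u x (extChartAt (𝓡 n) x x))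
          (fderiv ℝ (fun y => fderiv ℝ (coordGraph u x) y Y) (extChartAt (𝓡 n) x x) X) ν
        + N.christoffel x (coordGraph u x (extChartAt (𝓡 n) x x))
          (fderiv ℝ (coordGraph u x) (extChartAt (𝓡 n) x x) X)
          (fderiv ℝ (coordGraph u x) (extChartAt (𝓡 n) x x) Y) ν) := rfl
  rw [h1, coordGraph_self, fderiv_fderiv_coordGraph hu x hy, fderiv_coordGraph hu x hy,
    christoffel, N.fderiv_coordMetric hI x (graphPoint_mem hx),
    N.fderiv_coordMetric hI x (graphPoint_mem hx),
    N.fderiv_coordMetric hI x (graphPoint_mem hx), coordMetric_eq, chartψ_self]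
  simp only [J, T, map_zero, zero_apply]
  ring

lemma fderiv_chartσ_symm (N : GaussianSpacetime n S I) (hI : IsOpen I) (x₀ : S)
    {q : ℝ × EuclideanSpace ℝ (Fin n)} (hq : q ∈ I ×ˢ (extChartAt (𝓡 n) x₀).target)
    (Z : ℝ × EuclideanSpace ℝ (Fin n)) (ξ η : EuclideanSpace ℝ (Fin n)) :
    fderiv ℝ (N.chartσ x₀) q Z ξ η = fderiv ℝ (N.chartσ x₀) q Z η ξ := by
  have hσ := ((N.contDiffAt_chartσ hI x₀ hq).differentiableAt (by simp)).hasFDerivAt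
  have h1 : ∀ ξ η, fderiv ℝ (fun p => N.chartσ x₀ p ξ η) q Z =
      fderiv ℝ (N.chartσ x₀) q Z ξ η := fun ξ η => by
    rw [((hσ.clm_apply (hasFDerivAt_const ξ q)).clm_apply (hasFDerivAt_const η q)).fderiv]
    simp
  rw [← h1, ← h1]
  have h2 : (fun p => N.chartσ x₀ p ξ η) =ᶠ[𝓝 q] fun p => N.chartσ x₀ p η ξ := by
    filter_upwards [(hI.prod (isOpen_extChartAt_target x₀)).mem_nhds hq] with p hp
    exact N.chartσ_symm x₀ hp.1 ξ η
  rw [h2.fderiv_eq]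

lemma secondFundamentalForm_symm (N : GaussianSpacetime n S I) (hI : IsOpen I) {u : S → ℝ}
    (hu : ContMDiff (𝓡 n) 𝓘(ℝ, ℝ) 2 u) {x : S} (hx : u x ∈ I)
    (ν : ℝ × EuclideanSpace ℝ (Fin n)) (X Y : EuclideanSpace ℝ (Fin n)) :
    N.secondFundamentalForm u x ν X Y = N.secondFundamentalForm u x ν Y X := by
  rw [N.secondFundamentalForm_eq hI hu hx, N.secondFundamentalForm_eq hI hu hx]
  have h1 : fderiv ℝ (fderiv ℝ (chartFun u x)) (extChartAt (𝓡 n) x x) X Y =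
      fderiv ℝ (fderiv ℝ (chartFun u x)) (extChartAt (𝓡 n) x x) Y X :=
    ((contDiffAt_chartFun hu x (mem_extChartAt_target x)).isSymmSndFDerivAt (by simp)) X Y
  dsimp only
  rw [h1, N.chartσ_symm x (graphPoint_mem hx).1 (chartPush u x (extChartAt (𝓡 n) x x) X).2
      (chartPush u x (extChartAt (𝓡 n) x x) Y).2,
    N.fderiv_chartσ_symm hI x (graphPoint_mem hx) ν (chartPush u x (extChartAt (𝓡 n) x x) X).2]
  ring

/-! ### From principal curvatures to inequalities between forms. -/

/-- The second fundamental form as a bilinear form. -/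
def secondFundamentalBilin (N : GaussianSpacetime n S I) (hI : IsOpen I) {u : S → ℝ}
    (hu : ContMDiff (𝓡 n) 𝓘(ℝ, ℝ) 2 u) {x : S} (hx : u x ∈ I)
    (ν : ℝ × EuclideanSpace ℝ (Fin n)) :
    LinearMap.BilinForm ℝ (EuclideanSpace ℝ (Fin n)) := by
  have hadd : ∀ X X' Y : EuclideanSpace ℝ (Fin n), N.secondFundamentalForm u x ν (X + X') Y =
      N.secondFundamentalForm u x ν X Y + N.secondFundamentalForm u x ν X' Y := by
    intro X X' Y
    simp only [N.secondFundamentalForm_eq hI hu hx, map_add, add_apply, Prod.fst_add,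
      Prod.snd_add]
    ring
  have hsmul : ∀ (c : ℝ) (X Y : EuclideanSpace ℝ (Fin n)),
      N.secondFundamentalForm u x ν (c • X) Y = c • N.secondFundamentalForm u x ν X Y := by
    intro c X Y
    simp only [N.secondFundamentalForm_eq hI hu hx, map_smul, smul_apply, Prod.smul_fst,
      Prod.smul_snd, smul_eq_mul]
    ring
  refine LinearMap.mk₂ ℝ (fun X Y : EuclideanSpace ℝ (Fin n) => N.secondFundamentalForm u x ν X Y)
    hadd hsmul ?_ ?_
  · intro X Y Y'
    rw [N.secondFundamentalForm_symm hI hu hx, hadd,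
      N.secondFundamentalForm_symm hI hu hx _ Y, N.secondFundamentalForm_symm hI hu hx _ Y']
  · intro c X Y
    rw [N.secondFundamentalForm_symm hI hu hx, hsmul, N.secondFundamentalForm_symm hI hu hx _ Y]

/-- The induced metric as a bilinear form. -/
def inducedBilin (N : GaussianSpacetime n S I) (u : S → ℝ) (x : S) :
    LinearMap.BilinForm ℝ (EuclideanSpace ℝ (Fin n)) := by
  have hadd : ∀ X X' Y : TangentSpace (𝓡 n) x, N.inducedMetric u x (X + X') Y =
      N.inducedMetric u x X Y + N.inducedMetric u x X' Y := by
    intro X X' Y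
    simp only [inducedMetric_eq, map_add, add_apply]
    ring
  have hsmul : ∀ (c : ℝ) (X Y : TangentSpace (𝓡 n) x), N.inducedMetric u x (c • X) Y =
      c • N.inducedMetric u x X Y := by
    intro c X Y
    simp only [inducedMetric_eq, map_smul, smul_apply, smul_eq_mul]
    ring
  have hadd' : ∀ X Y Y' : TangentSpace (𝓡 n) x, N.inducedMetric u x X (Y + Y') =
      N.inducedMetric u x X Y + N.inducedMetric u x X Y' := by
    intro X Y Y'
    simp only [inducedMetric_eq, map_add]
    ring
  have hsmul' : ∀ (c : ℝ) (X Y : TangentSpace (𝓡 n) x), N.inducedMetric u x X (c • Y) =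
      c • N.inducedMetric u x X Y := by
    intro c X Y
    simp only [inducedMetric_eq, map_smul, smul_eq_mul]
    ring
  exact LinearMap.mk₂ ℝ (fun X Y : EuclideanSpace ℝ (Fin n) => N.inducedMetric u x X Y)
    hadd hsmul hadd' hsmul'

lemma inducedMetric_symm (N : GaussianSpacetime n S I) {u : S → ℝ} {x : S} (hx : u x ∈ I)
    (X Y : TangentSpace (𝓡 n) x) : N.inducedMetric u x X Y = N.inducedMetric u x Y X := by
  rw [inducedMetric_eq, inducedMetric_eq, N.symm _ hx x X Y, mul_comm (du u x X)]

lemma le_secondFundamentalForm (N : GaussianSpacetime n S I) (hI : IsOpen I) {u : S → ℝ}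
    (hu : ContMDiff (𝓡 n) 𝓘(ℝ, ℝ) 2 u) (hs : N.IsSpacelikeGraph u) {x : S} (hx : u x ∈ I)
    {ν : ℝ × TangentSpace (𝓡 n) x} (hν : N.IsPastNormal u x ν) {κ₀ : ℝ}
    (hκ : ∀ κ, N.IsPrincipalCurvature u x κ → κ₀ ≤ κ) (X : TangentSpace (𝓡 n) x) :
    κ₀ * N.inducedMetric u x X X ≤ N.secondFundamentalForm u x ν X X :=
  LinearMap.BilinForm.le_of_forall_relative_eigenvalue_ge
    (N.secondFundamentalBilin hI hu hx ν) (N.inducedBilin u x)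
    (N.secondFundamentalForm_symm hI hu hx ν) (N.inducedMetric_symm hx) (hs x)
    (fun m X hX h => hκ m ⟨ν, hν, X, hX, h⟩) X

lemma secondFundamentalForm_le (N : GaussianSpacetime n S I) (hI : IsOpen I) {u : S → ℝ}
    (hu : ContMDiff (𝓡 n) 𝓘(ℝ, ℝ) 2 u) (hs : N.IsSpacelikeGraph u) {x : S} (hx : u x ∈ I)
    {ν : ℝ × TangentSpace (𝓡 n) x} (hν : N.IsPastNormal u x ν) {κ₀ : ℝ}
    (hκ : ∀ κ, N.IsPrincipalCurvature u x κ → κ ≤ κ₀) (X : TangentSpace (𝓡 n) x) :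
    N.secondFundamentalForm u x ν X X ≤ κ₀ * N.inducedMetric u x X X :=
  LinearMap.BilinForm.le_of_forall_relative_eigenvalue_le
    (N.secondFundamentalBilin hI hu hx ν) (N.inducedBilin u x)
    (N.secondFundamentalForm_symm hI hu hx ν) (N.inducedMetric_symm hx) (hs x)
    (fun m X hX h => hκ m ⟨ν, hν, X, hX, h⟩) X

/-! ### The estimate at a minimum and its propagation. -/

/-- The first derivative test at a minimum of `(1 - |Du|²) e^{-μu}`, in the direction of `Du`.
For a fixed vector `ξ`, the function `2 Du(ξ) - σ(ξ, ξ)` touches `|Du|²` from below. -/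
lemma hessian_grad_of_isMin (N : GaussianSpacetime n S I) (hI : IsOpen I) {u : S → ℝ}
    (hu : ContMDiff (𝓡 n) 𝓘(ℝ, ℝ) 2 u) (huI : ∀ x, u x ∈ I) {x : S} {μ : ℝ}
    (hmin : ∀ z, (1 - N.gradSq u x) * Real.exp (-(μ * u x)) ≤
      (1 - N.gradSq u z) * Real.exp (-(μ * u z))) :
    let ξ : EuclideanSpace ℝ (Fin n) := N.grad u x
    2 * fderiv ℝ (fderiv ℝ (chartFun u x)) (extChartAt (𝓡 n) x x) ξ ξ =
      fderiv ℝ (N.chartσ x) (graphPoint u x) (N.gradSq u x, ξ) ξ ξ -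
        μ * (1 - N.gradSq u x) * N.gradSq u x := by
  intro ξ
  set y₀ := extChartAt (𝓡 n) x x
  have hy₀ : y₀ ∈ (extChartAt (𝓡 n) x).target := mem_extChartAt_target x
  have hux : chartFun u x y₀ = u x := congrArg Prod.fst (coordGraph_self u x)
  have hũ := contDiffAt_chartFun hu x hy₀
  have hd1 := (hũ.differentiableAt (by simp)).hasFDerivAt
  have hd2 := ((hũ.fderiv_right (m := 1) (by norm_num)).differentiableAt (by simp)).hasFDerivAt
  have hp : (chartFun u x y₀, y₀) = graphPoint u x := by rw [hux]; rfl
  have hσ : HasFDerivAt (N.chartσ x) (fderiv ℝ (N.chartσ x) (graphPoint u x))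
      (chartFun u x y₀, y₀) := by
    rw [hp]
    exact ((N.contDiffAt_chartσ hI x (graphPoint_mem (huI x))).differentiableAt
      (by simp)).hasFDerivAt
  have hσ' := HasFDerivAt.comp (g := N.chartσ x) (f := fun y => (chartFun u x y, y)) y₀ hσ (hd1.prodMk (hasFDerivAt_id y₀))
  have hL := ((hd2.clm_apply (hasFDerivAt_const ξ y₀)).const_mul 2).sub
    ((hσ'.clm_apply (hasFDerivAt_const ξ y₀)).clm_apply (hasFDerivAt_const ξ y₀))
  have hW := (hL.const_sub 1).mul ((hd1.const_mul μ).neg).exp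
  have hG : fderiv ℝ (chartFun u x) y₀ ξ = N.gradSq u x := fderiv_chartFun_self hu x ξ
  have hG' : N.chartσ x (graphPoint u x) ξ ξ = N.gradSq u x := by
    rw [chartσ_self, gradSq_eq_σ N (huI x)]
  -- The barrier from `le_gradSq`, with the coordinate vector `ξ` frozen, lies below `|Du|²` and
  -- agrees with it at `y₀`, so the minimum at `y₀` is inherited.
  have hloc : IsLocalMin (fun y => (1 - (2 * fderiv ℝ (chartFun u x) y ξ -
      N.chartσ x (chartFun u x y, y) ξ ξ)) * Real.exp (-(μ * chartFun u x y))) y₀ := by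
    filter_upwards [(isOpen_extChartAt_target x).mem_nhds hy₀] with y hy
    rw [hp, hG, hG', hux]
    have h1 := N.le_gradSq (huI ((extChartAt (𝓡 n) x).symm y)) (chartDeriv x y ξ)
    rw [← fderiv_chartFun hu x hy] at h1
    have h2 := hmin ((extChartAt (𝓡 n) x).symm y)
    rw [show 1 - (2 * N.gradSq u x - N.gradSq u x) = 1 - N.gradSq u x by ring]
    refine h2.trans (mul_le_mul_of_nonneg_right ?_ (Real.exp_pos _).le)
    have h3 : N.chartσ x (chartFun u x y, y) ξ ξ = N.σ (u ((extChartAt (𝓡 n) x).symm y)) _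
      (chartDeriv x y ξ) (chartDeriv x y ξ) := rfl
    rw [h3]
    linarith
  have h0 := congrArg (fun f : EuclideanSpace ℝ (Fin n) →L[ℝ] ℝ => f ξ)
    (hloc.hasFDerivAt_eq_zero hW)
  simp [hG, hp, hG'] at h0
  refine mul_left_cancel₀ (Real.exp_pos (-(μ * chartFun u x y₀))).ne' ?_
  linear_combination -h0

lemma secondFundamentalForm_grad_of_isMin (N : GaussianSpacetime n S I) (hI : IsOpen I)
    {u : S → ℝ} (hu : ContMDiff (𝓡 n) 𝓘(ℝ, ℝ) 2 u) (huI : ∀ x, u x ∈ I) {x : S} {μ : ℝ}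
    (hmin : ∀ z, (1 - N.gradSq u x) * Real.exp (-(μ * u x)) ≤
      (1 - N.gradSq u z) * Real.exp (-(μ * u z))) :
    N.secondFundamentalForm u x (N.pastNormal u x) (N.grad u x) (N.grad u x) =
      Real.exp (2 * N.ψ (u x) x) * (N.vTilde u x * Real.exp (-N.ψ (u x) x)) *
        (1 - N.gradSq u x) * (N.gradSq u x * (μ / 2 - deriv (fun s => N.ψ s x) (u x) -
          du (N.ψ (u x)) x (N.grad u x)) -
          1 / 2 * deriv (fun s => N.σ s x (N.grad u x) (N.grad u x)) (u x)) := by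
  set s := N.vTilde u x * Real.exp (-N.ψ (u x) x) with hs
  set ξ : EuclideanSpace ℝ (Fin n) := N.grad u x with hξ
  have hD := N.hessian_grad_of_isMin hI hu huI hmin
  simp only [← hξ] at hD
  have hν : N.pastNormal u x = (-s) • ((1 : ℝ), ξ) := rfl
  have hJ : chartPush u x (extChartAt (𝓡 n) x x) ξ = (N.gradSq u x, ξ) :=
    Prod.ext (fderiv_chartFun_self hu x ξ) rfl
  have hG : N.chartσ x (graphPoint u x) ξ ξ = N.gradSq u x := by
    rw [chartσ_self, gradSq_eq_σ N (huI x)]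
  have h1 := N.fderiv_chartσ_time_self hI (huI x) ξ
  have h2 := N.fderiv_chartψ_time_self hI (huI x)
  have h3 := N.fderiv_chartψ_space_self hI (huI x) ξ
  have hsplit : ∀ t : ℝ, ((t, ξ) : ℝ × EuclideanSpace ℝ (Fin n)) = t • (1, 0) + (0, ξ) := by
    intro t
    simp
  -- `B` is the spatial derivative of `σ` along `ξ`; it cancels in the final combination.
  obtain ⟨B, hdσ⟩ : ∃ B, ∀ t, fderiv ℝ (N.chartσ x) (graphPoint u x) (t, ξ) ξ ξ =
      t * deriv (fun s => N.σ s x ξ ξ) (u x) + B := by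
    refine ⟨fderiv ℝ (N.chartσ x) (graphPoint u x) (0, ξ) ξ ξ, fun t => ?_⟩
    rw [hsplit, map_add, map_smul, ← h1]
    simp
  have hdψ : fderiv ℝ (N.chartψ x) (graphPoint u x) (1, ξ) =
      deriv (fun s => N.ψ s x) (u x) + du (N.ψ (u x)) x ξ := by
    rw [hsplit, map_add, map_smul, h2, h3, one_smul]
  have h4 := N.secondFundamentalForm_eq hI hu (huI x) ((-s) • ((1 : ℝ), ξ)) ξ ξ
  dsimp only at h4
  rw [hJ] at h4
  simp only [Prod.smul_fst, Prod.smul_snd, map_smul, smul_eq_mul, smul_apply, hG, hdψ,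
    hdσ] at h4
  rw [hdσ] at hD
  rw [hν]
  refine h4.trans ?_
  linear_combination (-1 / 2 * s * Real.exp (2 * N.ψ (u x) x)) * hD

/-- The curvature condition bounds `ṽ` at a minimum of `(1 - |Du|²) e^{-μu}`, for a suitable `μ`
that depends on the geometry and on the side of the condition only. -/
lemma vTilde_le_of_isMin (N : GaussianSpacetime n S I) (hI : IsOpen I) {u : S → ℝ}
    (hu : ContMDiff (𝓡 n) 𝓘(ℝ, ℝ) 2 u) (huI : ∀ x, u x ∈ I) (hs : N.IsSpacelikeGraph u)
    {x : S} {C κ₀ μ : ℝ} (hC : N.IsGeometryBound C (u x) x)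
    (hmin : ∀ z, (1 - N.gradSq u x) * Real.exp (-(μ * u x)) ≤
      (1 - N.gradSq u z) * Real.exp (-(μ * u z)))
    (hκ : (μ = -(2 * (1 + 3 * C)) ∧ ∀ κ, N.IsPrincipalCurvature u x κ → κ₀ ≤ κ) ∨
      (μ = 2 * (1 + 3 * C) ∧ ∀ κ, N.IsPrincipalCurvature u x κ → κ ≤ κ₀)) :
    N.vTilde u x ≤ 1 + |κ₀| * C := by
  have hC0 : 0 < C := (Real.exp_pos _).trans_le hC.exp_le
  by_cases hξ : N.grad u x = 0
  · have : N.vTilde u x = 1 := by simp [vTilde, gradSq_eq_du, hξ]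
    rw [this]
    have : 0 ≤ |κ₀| * C := by positivity
    linarith
  have hG1 := hs.gradSq_lt_one (huI x)
  have hG0 := gradSq_pos N (huI x) hξ
  have hν := N.isPastNormal_pastNormal (huI x) hG1
  have hII := N.secondFundamentalForm_grad_of_isMin hI hu huI hmin
  have hg := N.inducedMetric_grad (huI x)
  have hg0 := hs x _ hξ
  have hσ := abs_le.1 (hC.time_σ (N.grad u x))
  rw [← gradSq_eq_σ N (huI x)] at hσ
  have hψ := abs_le.1 hC.time_ψ
  have hψ' := abs_le.1 (hC.space_ψ (N.grad u x) (by rw [← gradSq_eq_σ N (huI x)]; exact hG1.le))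
  set G := N.gradSq u x
  set A := deriv (fun s => N.σ s x (N.grad u x) (N.grad u x)) (u x)
  set p := deriv (fun s => N.ψ s x) (u x)
  set d := du (N.ψ (u x)) x (N.grad u x)
  set s := N.vTilde u x * Real.exp (-N.ψ (u x) x) with hsdef
  have hv0 : 0 ≤ N.vTilde u x := by rw [vTilde]; positivity
  have hs0 : 0 ≤ s := by positivity
  have hw : 0 ≤ Real.exp (2 * N.ψ (u x) x) * s * (1 - G) := by
    have : 0 ≤ 1 - G := by linarith
    positivity
  have hsκ : s ≤ |κ₀| := by
    refine le_of_mul_le_mul_right ?_ hg0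
    rcases hκ with ⟨hμ, hκ⟩ | ⟨hμ, hκ⟩
    · have h1 := N.le_secondFundamentalForm hI hu hs (huI x) hν hκ (N.grad u x)
      -- `μ / 2 = -(1 + 3C)`: two of the `C` absorb `p` and `d`, and half of the third absorbs the
      -- term in `A`.
      have h2 : G * (μ / 2 - p - d) - 1 / 2 * A ≤ -G := by
        have h3 : G * (μ / 2 - p - d) ≤ G * (-(1 + C)) :=
          mul_le_mul_of_nonneg_left (by rw [hμ]; linarith) hG0.le
        nlinarith [mul_pos hC0 hG0]
      have h3 := mul_le_mul_of_nonneg_left h2 hw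
      rw [← hII] at h3
      have h4 : s * N.inducedMetric u x (N.grad u x) (N.grad u x) ≤
          -κ₀ * N.inducedMetric u x (N.grad u x) (N.grad u x) := by
        linear_combination h1 + h3 + s * hg
      exact h4.trans (mul_le_mul_of_nonneg_right (neg_le_abs κ₀) hg0.le)
    · have h1 := N.secondFundamentalForm_le hI hu hs (huI x) hν hκ (N.grad u x)
      have h2 : G ≤ G * (μ / 2 - p - d) - 1 / 2 * A := by
        have h3 : G * (1 + C) ≤ G * (μ / 2 - p - d) :=
          mul_le_mul_of_nonneg_left (by rw [hμ]; linarith) hG0.le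
        nlinarith [mul_pos hC0 hG0]
      have h3 := mul_le_mul_of_nonneg_left h2 hw
      rw [← hII] at h3
      have h4 : s * N.inducedMetric u x (N.grad u x) (N.grad u x) ≤
          κ₀ * N.inducedMetric u x (N.grad u x) (N.grad u x) := by
        linear_combination h1 + h3 + s * hg
      exact h4.trans (mul_le_mul_of_nonneg_right (le_abs_self κ₀) hg0.le)
  have hvs : N.vTilde u x = s * Real.exp (N.ψ (u x) x) := by
    rw [hsdef, mul_assoc, ← Real.exp_add]
    simp
  have : s * Real.exp (N.ψ (u x) x) ≤ |κ₀| * C :=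
    mul_le_mul hsκ hC.exp_le (Real.exp_pos _).le (abs_nonneg _)
  linarith

/-- A bound for `ṽ` at a minimum of `(1 - |Du|²) e^{-μu}` implies a bound everywhere. -/
lemma vTilde_le_of_vTilde_le_at_isMin (N : GaussianSpacetime n S I) {u : S → ℝ} {x₀ : S}
    {a b K μ : ℝ} (hG : N.gradSq u x₀ < 1) (hab : ∀ x, u x ∈ Icc a b)
    (hmin : ∀ z, (1 - N.gradSq u x₀) * Real.exp (-(μ * u x₀)) ≤
      (1 - N.gradSq u z) * Real.exp (-(μ * u z)))
    (hK : N.vTilde u x₀ ≤ K) (x : S) :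
    N.vTilde u x ≤ 1 / √((1 / K) ^ 2 * Real.exp (-(|μ| * (b - a)))) := by
  have h0 : 0 < √(1 - N.gradSq u x₀) := Real.sqrt_pos.2 (by linarith)
  have hK0 : 0 < K := lt_of_lt_of_le (by rw [vTilde]; positivity) hK
  have h1 : (1 / K) ^ 2 ≤ 1 - N.gradSq u x₀ := by
    rw [← Real.le_sqrt' (by positivity), div_le_comm₀ hK0 h0]
    exact hK
  -- Comparing the weights at `x₀` and `x` costs only the oscillation of `u`.
  have h2 : Real.exp (-(|μ| * (b - a))) ≤ Real.exp (-(μ * u x₀)) * Real.exp (μ * u x) := by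
    rw [← Real.exp_add, Real.exp_le_exp]
    have h3 : |u x₀ - u x| ≤ b - a := by
      rw [abs_le]
      constructor <;> linarith [(hab x₀).1, (hab x₀).2, (hab x).1, (hab x).2]
    have h4 : μ * (u x₀ - u x) ≤ |μ| * (b - a) :=
      (le_abs_self _).trans ((abs_mul _ _).trans_le
        (mul_le_mul_of_nonneg_left h3 (abs_nonneg _)))
    linarith
  have h5 : (1 / K) ^ 2 * Real.exp (-(|μ| * (b - a))) ≤ 1 - N.gradSq u x := by
    calc (1 / K) ^ 2 * Real.exp (-(|μ| * (b - a)))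
        ≤ (1 - N.gradSq u x₀) * (Real.exp (-(μ * u x₀)) * Real.exp (μ * u x)) := by gcongr
      _ = (1 - N.gradSq u x₀) * Real.exp (-(μ * u x₀)) * Real.exp (μ * u x) := by ring
      _ ≤ (1 - N.gradSq u x) * Real.exp (-(μ * u x)) * Real.exp (μ * u x) :=
        mul_le_mul_of_nonneg_right (hmin x) (Real.exp_pos _).le
      _ = 1 - N.gradSq u x := by
        rw [mul_assoc, ← Real.exp_add]
        simp
  rw [vTilde]
  have h6 : 0 < (1 / K) ^ 2 * Real.exp (-(|μ| * (b - a))) := by positivity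
  gcongr

end GaussianSpacetime

end

end

theorem mainTheorem9 {n : ℕ} {S : Type*} [TopologicalSpace S]
    [ChartedSpace (EuclideanSpace ℝ (Fin n)) S] [IsManifold (𝓡 n) ∞ S]
    [CompactSpace S] [T2Space S]
    {I : Set ℝ} (hI : IsOpen I) (hI' : I.OrdConnected)
    (N : GaussianSpacetime n S I) (κ₀ a b : ℝ) (hab : Icc a b ⊆ I) :
    ∃ c : ℝ, ∀ u : S → ℝ, ContMDiff (𝓡 n) 𝓘(ℝ, ℝ) 2 u →
      (∀ x, u x ∈ Icc a b) → N.IsSpacelikeGraph u →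
      ((∀ x κ, N.IsPrincipalCurvature u x κ → κ₀ ≤ κ) ∨
        (∀ x κ, N.IsPrincipalCurvature u x κ → κ ≤ κ₀)) →
      ∀ x, N.vTilde u x ≤ c := by
  obtain ⟨C, hC⟩ := N.exists_isGeometryBound hI hab
  -- Only `|μ|` enters, so one constant serves both sides of the curvature condition.
  refine ⟨1 / √((1 / (1 + |κ₀| * C)) ^ 2 * Real.exp (-(|2 * (1 + 3 * C)| * (b - a)))), ?_⟩
  intro u hu hu_mem hs hκ x
  have huI : ∀ x, u x ∈ I := fun x => hab (hu_mem x)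
  obtain ⟨μ, hμ, hκμ⟩ : ∃ μ, |μ| = |2 * (1 + 3 * C)| ∧ ∀ x,
      (μ = -(2 * (1 + 3 * C)) ∧ ∀ κ, N.IsPrincipalCurvature u x κ → κ₀ ≤ κ) ∨
      (μ = 2 * (1 + 3 * C) ∧ ∀ κ, N.IsPrincipalCurvature u x κ → κ ≤ κ₀) := by
    rcases hκ with hκ | hκ
    · exact ⟨_, abs_neg _, fun x => Or.inl ⟨rfl, hκ x⟩⟩
    · exact ⟨_, rfl, fun x => Or.inr ⟨rfl, hκ x⟩⟩
  have : Nonempty S := ⟨x⟩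
  have hcont : Continuous fun z => (1 - N.gradSq u z) * Real.exp (-(μ * u z)) :=
    (continuous_const.sub (N.continuous_gradSq hI hu huI)).mul
      (continuous_const.mul hu.continuous).neg.rexp
  obtain ⟨x₀, -, hx₀⟩ := isCompact_univ.exists_isMinOn univ_nonempty hcont.continuousOn
  have hmin : ∀ z, (1 - N.gradSq u x₀) * Real.exp (-(μ * u x₀)) ≤
      (1 - N.gradSq u z) * Real.exp (-(μ * u z)) := fun z => hx₀ (mem_univ z)
  have hK := N.vTilde_le_of_isMin hI hu huI hs (hC _ (hu_mem x₀) x₀) hmin (hκμ x₀)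
  rw [← hμ]
  exact N.vTilde_le_of_vTilde_le_at_isMin (hs.gradSq_lt_one (huI x₀)) hu_mem hmin hK x
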